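/- For real $x>0$ let $$L^*(x)=\lfloor\log_2 x\rfloor+2\bigl(1-2^{\lfloor\log_2 x\rfloor-\log_2 x}\bigr).$$ Consider the binary erasure channel BEC$(\delta)$, $0\le\delta<1$, with input alphabet $\{0,1\}$, output alphabet $\{0,\mathsf e,1\}$ and transition probabilities $P(\mathsf e\mid x)=\delta$, $P(x\mid x)=1-\delta$. For a real $L\ge 0$, an integer $M\ge 1$ and $\epsilon\in[0,1]$, an $(L,M,\epsilon)$ variable-length feedback (VLF) code over BEC$(\delta)$ consists of 1. a random variable $U$ with values in a set $\mathcal U$ with $|\mathcal U|\le 2$, known to encoder and decoder, and independent of the message $W$, which is uniformly distributed on $\{1,\dots,M\}$; 2. encoders $f_n:\mathcal U\times\{1,\dots,M\}\times\{0,\mathsf e,1\}^{n-1}\to\{0,1\}$, $n\ge1$, giving the channel inputs $X_n=f_n(U,W,Y_1,\dots,Y_{n-1})$, where, conditionally on $(U,W,Y_1,\dots,Y_{n-1})$, the output $Y_n$ has the distribution $P(\cdot\mid X_n)$; 3. decoders $g_n:\mathcal U\times\{0,\mathsf e,1\}^n\to\{1,\dots,M\}$, $n\ge0$; 4. a random variable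 $\tau$ with values in $\{0,1,2,\dots\}$, which is a stopping time of the filtration $\mathcal G_n=\sigma(U,Y_1,\dots,Y_n)$, with $\mathbb E[\tau]\le L$, such that $\Pr[g_\tau(U,Y_1,\dots,Y_\tau)\ne W]\le\epsilon$. Then for every $\delta\in[0,1)$ and every integer $M\ge1$, the minimum $$L^*_{\mathrm f}(M,0)=\min\{L\ge 0:\ \text{there is an }(L,M,0)\text{ VLF code over BEC}(\delta)\}$$ exists and equals $$\frac{L^*(M)}{1-\delta}.$$ That is, there is an $(L,M,0)$ VLF code with $L=L^*(M)/(1-\delta)$, and every $(L,M,0)$ VLF code satisfies $L\ge L^*(M)/(1-\delta)$. -/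

import Mathlib

open MeasureTheory ProbabilityTheory
open scoped ENNReal

/-- The function `L*(x) = ⌊log₂ x⌋ + 2 (1 - 2 ^ (⌊log₂ x⌋ - log₂ x))`. -/
noncomputable def lstar (x : ℝ) : ℝ :=
  (⌊Real.logb 2 x⌋ : ℝ) + 2 * (1 - (2 : ℝ) ^ ((⌊Real.logb 2 x⌋ : ℝ) - Real.logb 2 x))

/-- The output alphabet `{0, e, 1}` of the binary erasure channel: `none` is the erasure and
`some b` is the correctly received bit `b`. The input alphabet is `Bool`. -/
abbrev BECOutput : Type := Option Bool

/-- The output alphabet carries the discrete σ-algebra. -/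
instance BECOutput.instMeasurableSpace : MeasurableSpace BECOutput := ⊤

/-- The transition probabilities `P(y | x)` of the binary erasure channel with erasure
probability `δ`. -/
def becTransition (δ : ℝ) (x : Bool) (y : BECOutput) : ℝ :=
  match y with
  | none => δ
  | some b => if b = x then 1 - δ else 0

/-- The filtration `𝒢 n = σ(U, Y₁, …, Yₙ)`. The process is indexed from zero, so that `Y k` is the
channel output at time `k + 1` and `𝒢 n` is generated by `U` and the `Y k` with `k < n`. -/
def feedbackFiltration {Ω S : Type} [mΩ : MeasurableSpace Ω] [mS : MeasurableSpace S]
    (U : Ω → S) (Y : ℕ → Ω → BECOutput) (hU : Measurable U) (hY : ∀ k, Measurable (Y k)) :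
    Filtration ℕ mΩ where
  seq n := MeasurableSpace.comap U mS ⊔
    ⨆ k : ℕ, ⨆ _ : k < n, MeasurableSpace.comap (Y k) BECOutput.instMeasurableSpace
  mono' := by
    intro i j hij
    refine sup_le_sup le_rfl (iSup_mono fun k => ?_)
    exact iSup_le fun hk => le_iSup_of_le (lt_of_lt_of_le hk hij) le_rfl
  le' _ := sup_le hU.comap_le (iSup_le fun k => iSup_le fun _ => (hY k).comap_le)

/-- An `(L, M, ε)` variable-length feedback code operating over the binary erasure channel with
erasure probability `δ`, together with the random variables that it induces. -/
structure VLFCode (δ L : ℝ) (M : ℕ) (ε : ℝ) where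
  L_nonneg : 0 ≤ L
  ε_mem : ε ∈ Set.Icc (0 : ℝ) 1
  /-- The set in which the common randomness takes its values; it has at most two elements. -/
  S : Type
  [fintypeS : Fintype S]
  [measurableSpaceS : MeasurableSpace S]
  [discreteS : DiscreteMeasurableSpace S]
  card_S_le : Fintype.card S ≤ 2
  /-- The encoders: `enc n` maps the common randomness, the message and the first `n` channel
  outputs to the channel input at time `n + 1`. -/
  enc : (n : ℕ) → S → Fin M → (Fin n → BECOutput) → Bool
  /-- The decoders: `dec n` estimates the message from the common randomness and the first `n`
  channel outputs. -/
  dec : (n : ℕ) → S → (Fin n → BECOutput) → Fin M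
  /-- The probability space. -/
  Ω : Type
  [measurableSpaceΩ : MeasurableSpace Ω]
  μ : Measure Ω
  [isProbabilityMeasure : IsProbabilityMeasure μ]
  /-- The common randomness. -/
  U : Ω → S
  /-- The message. -/
  W : Ω → Fin M
  /-- The channel outputs: `Y n` is the output at time `n + 1`. -/
  Y : ℕ → Ω → BECOutput
  measurable_U : Measurable U
  measurable_W : Measurable W
  measurable_Y : ∀ n, Measurable (Y n)
  /-- The message is uniformly distributed. -/
  uniform_W : ∀ w : Fin M, μ.real {ω | W ω = w} = 1 / (M : ℝ)
  /-- The common randomness is independent of the message. -/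
  indep_U_W : IndepFun U W μ
  /-- Given `U`, `W` and the first `n` outputs, the next output is that of the channel for the
  input `enc n U W (Y 0, …, Y (n - 1))`. -/
  channel : ∀ (n : ℕ) (u : S) (w : Fin M) (y : Fin n → BECOutput) (b : BECOutput),
    μ.real {ω | U ω = u ∧ W ω = w ∧ (∀ k : Fin n, Y k ω = y k) ∧ Y n ω = b} =
      μ.real {ω | U ω = u ∧ W ω = w ∧ ∀ k : Fin n, Y k ω = y k} *
        becTransition δ (enc n u w y) b
  /-- The (integer-valued) time at which the transmission stops. -/
  τ : Ω → ℕ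
  isStoppingTime : IsStoppingTime (feedbackFiltration U Y measurable_U measurable_Y)
    (fun ω => (τ ω : WithTop ℕ))
  /-- The average blocklength is at most `L`. -/
  expectation_le : ∫⁻ ω, (τ ω : ℝ≥0∞) ∂μ ≤ ENNReal.ofReal L
  /-- The final estimate differs from the message with probability at most `ε`. -/
  error_le : μ.real {ω | dec (τ ω) (U ω) (fun k => Y k ω) ≠ W ω} ≤ ε

/-- The set of all `L` for which an `(L, M, ε)` variable-length feedback code over the binary
erasure channel with erasure probability `δ` exists. Its least element is the minimum average
blocklength. -/
def vlfBlocklengths (δ : ℝ) (M : ℕ) (ε : ℝ) : Set ℝ :=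
  {L | Nonempty (VLFCode δ L M ε)}

/-!
Let `N n` be the number of messages consistent with `U` and the first `n` channel outputs. Given
these observations, the surviving messages are equally likely. A channel use leaves them unchanged
with probability `δ`, and otherwise keeps one of the two parts into which the channel input splits
them, with a probability proportional to its size. Since `x * L*(x)` interpolates `x * log₂ x`
between powers of two, splitting `x` messages into two parts lowers the total of `x * L*(x)` by at
most `x`, and by exactly `x` when the parts are halves. Hence
`𝔼[L*(N n)] ≤ 𝔼[L*(N (n + 1))] + (1 - δ) ℙ(2 ≤ N n)`, with equality if the encoder halves.

In a code without errors, `2 ≤ N n` forces `n < τ` almost surely, so summing over `n` gives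
`L*(M) ≤ (1 - δ) 𝔼[τ]`. A halving encoder with `τ` the first time at which `N n ≤ 1` attains this
bound.
-/

/-- The affine function interpolating `x * log₂ x` at `x = 2 ^ j` and `x = 2 ^ (j + 1)`. -/
noncomputable def entropyChord (j : ℤ) (x : ℝ) : ℝ := x * (j + 2) - 2 ^ (j + 1)

/-- The total codeword length `x * L*(x)` of an optimal binary prefix code for `x` equally likely
messages, extended to real `x`. It interpolates `x * log₂ x` linearly between consecutive powers
of two. -/
noncomputable def totalLength (x : ℝ) : ℝ := x * lstar x

theorem add_one_le_two_zpow (e : ℤ) : (e : ℝ) + 1 ≤ 2 ^ e := by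
  rcases le_or_gt 0 e with he | he
  · lift e to ℕ using he
    exact_mod_cast Nat.lt_two_pow_self (n := e)
  · have h : (e : ℝ) + 1 ≤ 0 := by exact_mod_cast he
    exact h.trans (by positivity)

theorem entropyChord_le_entropyChord {x : ℝ} {k : ℤ} (hx : x ∈ Set.Icc ((2 : ℝ) ^ k) (2 ^ (k + 1)))
    (j : ℤ) : entropyChord j x ≤ entropyChord k x := by
  obtain ⟨d, rfl⟩ : ∃ d, j = k + d := ⟨j - k, by ring⟩
  obtain ⟨hkx, hxk⟩ := hx
  have h_double : (2 : ℝ) ^ (k + 1) = 2 * 2 ^ k := by rw [zpow_add_one₀ two_ne_zero, mul_comm]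
  have h_shift : (2 : ℝ) ^ (k + d + 1) = 2 * (2 ^ k * 2 ^ d) := by
    rw [zpow_add_one₀ two_ne_zero, zpow_add₀ two_ne_zero, mul_comm]
  -- Both sides are affine in `x`, so it suffices to compare them at `2 ^ (k + 1)` and at `2 ^ k`.
  have h_right : 0 ≤ (x - 2 ^ k) * (2 ^ d - (d + 1)) :=
    mul_nonneg (sub_nonneg.2 hkx) (sub_nonneg.2 (add_one_le_two_zpow d))
  have h_left : 0 ≤ (2 * 2 ^ k - x) * (2 * 2 ^ d - (d + 2)) := by
    have h := add_one_le_two_zpow (d + 1)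
    rw [zpow_add_one₀ two_ne_zero] at h
    push_cast at h
    exact mul_nonneg (sub_nonneg.2 (h_double ▸ hxk)) (by linarith)
  rw [entropyChord, entropyChord, h_double, h_shift]
  push_cast
  linarith

theorem mem_Icc_two_zpow_floor_logb {x : ℝ} (hx : 0 < x) :
    x ∈ Set.Icc ((2 : ℝ) ^ ⌊Real.logb 2 x⌋) (2 ^ (⌊Real.logb 2 x⌋ + 1)) := by
  have hlog : (2 : ℝ) ^ Real.logb 2 x = x := Real.rpow_logb two_pos (by norm_num) hx
  simp only [Set.mem_Icc, ← Real.rpow_intCast]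
  constructor
  · exact (Real.rpow_le_rpow_of_exponent_le one_le_two (Int.floor_le _)).trans_eq hlog
  · refine hlog.symm.trans_le (Real.rpow_le_rpow_of_exponent_le one_le_two ?_)
    push_cast
    exact (Int.lt_floor_add_one _).le

theorem totalLength_eq_entropyChord_floor_logb {x : ℝ} (hx : 0 < x) :
    totalLength x = entropyChord ⌊Real.logb 2 x⌋ x := by
  rw [totalLength, lstar, entropyChord, Real.rpow_sub two_pos,
    Real.rpow_logb two_pos (by norm_num) hx, Real.rpow_intCast, zpow_add_one₀ two_ne_zero]
  field_simp
  ring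

theorem entropyChord_le_totalLength {x : ℝ} (hx : 0 ≤ x) (j : ℤ) :
    entropyChord j x ≤ totalLength x := by
  rcases hx.eq_or_lt with rfl | hx
  · simp only [entropyChord, totalLength, zero_mul, zero_sub, Left.neg_nonpos_iff]
    positivity
  · rw [totalLength_eq_entropyChord_floor_logb hx]
    exact entropyChord_le_entropyChord (mem_Icc_two_zpow_floor_logb hx) j

theorem totalLength_eq_entropyChord {x : ℝ} {j : ℤ}
    (hx : x ∈ Set.Icc ((2 : ℝ) ^ j) (2 ^ (j + 1))) : totalLength x = entropyChord j x := by
  have hx0 : 0 < x := (zpow_pos two_pos j).trans_le hx.1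
  refine le_antisymm ?_ (entropyChord_le_totalLength hx0.le j)
  rw [totalLength_eq_entropyChord_floor_logb hx0]
  exact entropyChord_le_entropyChord hx _

theorem entropyChord_succ_add (j : ℤ) (x y : ℝ) :
    entropyChord (j + 1) (x + y) = entropyChord j x + entropyChord j y + (x + y) := by
  simp only [entropyChord, zpow_add_one₀ (two_ne_zero' ℝ)]
  push_cast
  ring

theorem totalLength_add_le {x y : ℝ} (hx : 0 ≤ x) (hy : 0 ≤ y) :
    totalLength (x + y) ≤ totalLength x + totalLength y + (x + y) := by
  rcases (add_nonneg hx hy).eq_or_lt with h | h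
  · obtain ⟨rfl, rfl⟩ := (add_eq_zero_iff_of_nonneg hx hy).1 h.symm
    simp [totalLength]
  · rw [totalLength_eq_entropyChord_floor_logb h, ← sub_add_cancel ⌊Real.logb 2 (x + y)⌋ 1,
      entropyChord_succ_add]
    gcongr <;> exact entropyChord_le_totalLength ‹_› _

theorem totalLength_add {x y : ℝ} {j : ℤ} (hx : x ∈ Set.Icc ((2 : ℝ) ^ j) (2 ^ (j + 1)))
    (hy : y ∈ Set.Icc ((2 : ℝ) ^ j) (2 ^ (j + 1))) :
    totalLength (x + y) = totalLength x + totalLength y + (x + y) := by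
  have hxy : x + y ∈ Set.Icc ((2 : ℝ) ^ (j + 1)) (2 ^ (j + 1 + 1)) := by
    constructor <;> rw [zpow_add_one₀ two_ne_zero, mul_two]
    exacts [add_le_add hx.1 hy.1, add_le_add hx.2 hy.2]
  rw [totalLength_eq_entropyChord hxy, entropyChord_succ_add, totalLength_eq_entropyChord hx,
    totalLength_eq_entropyChord hy]

theorem totalLength_natCast_half {m : ℕ} (hm : 2 ≤ m) :
    totalLength m = totalLength (m / 2 : ℕ) + totalLength (m - m / 2 : ℕ) + m := by
  obtain ⟨k, hk⟩ : ∃ k, Nat.log 2 m = k + 1 :=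
    Nat.exists_eq_succ_of_ne_zero (Nat.log_pos one_lt_two hm).ne'
  have h_lower : 2 ^ k * 2 ≤ m := by
    rw [← pow_succ, ← hk]
    exact Nat.pow_log_le_self 2 (by lia)
  have h_upper : m < 2 ^ (k + 1) * 2 := by
    rw [← pow_succ, ← hk]
    exact Nat.lt_pow_succ_log_self one_lt_two m
  have h_mem (a : ℕ) (h : 2 ^ k ≤ a ∧ a ≤ 2 ^ (k + 1)) :
      (a : ℝ) ∈ Set.Icc ((2 : ℝ) ^ (k : ℤ)) (2 ^ ((k : ℤ) + 1)) :=
    ⟨by exact_mod_cast h.1, by exact_mod_cast h.2⟩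
  have h := totalLength_add (h_mem (m / 2) (by lia)) (h_mem (m - m / 2) (by lia))
  rwa [← Nat.cast_add, Nat.add_sub_cancel' (Nat.div_le_self m 2)] at h

theorem lstar_mono {x y : ℝ} (hx : 0 < x) (hxy : x ≤ y) : lstar x ≤ lstar y := by
  have hy := hx.trans_le hxy
  set k := ⌊Real.logb 2 x⌋ with hk
  calc
    lstar x = totalLength x / x := (mul_div_cancel_left₀ _ hx.ne').symm
    _ = k + 2 - 2 ^ (k + 1) / x := by
      rw [totalLength_eq_entropyChord_floor_logb hx, ← hk, entropyChord]
      field_simp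
    _ ≤ k + 2 - 2 ^ (k + 1) / y := by gcongr
    _ = entropyChord k y / y := by
      rw [entropyChord]
      field_simp
    _ ≤ totalLength y / y := by
      gcongr
      exact entropyChord_le_totalLength hy.le k
    _ = lstar y := mul_div_cancel_left₀ _ hy.ne'

theorem lstar_one : lstar 1 = 0 := by simp [lstar]

theorem lstar_nonneg {x : ℝ} (hx : 1 ≤ x) : 0 ≤ lstar x :=
  lstar_one.symm.trans_le (lstar_mono one_pos hx)

theorem lstar_natCast_of_le_one {m : ℕ} (hm : m ≤ 1) : lstar m = 0 := by
  interval_cases m <;> simp [lstar]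

theorem lstar_natCast_le_mul_ite {m n : ℕ} (hmn : m ≤ n) :
    lstar m ≤ lstar n * if 2 ≤ m then 1 else 0 := by
  split_ifs with hm
  · rw [mul_one]
    exact lstar_mono (by positivity) (by exact_mod_cast hmn)
  · rw [lstar_natCast_of_le_one (by lia), mul_zero]

theorem totalLength_natCast_of_le_one {m : ℕ} (hm : m ≤ 1) : totalLength m = 0 := by
  rw [totalLength, lstar_natCast_of_le_one hm, mul_zero]

theorem lstar_natCast_nonneg (m : ℕ) : 0 ≤ lstar m := by
  rcases le_or_gt m 1 with hm | hm
  · rw [lstar_natCast_of_le_one hm]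
  · exact lstar_nonneg (by exact_mod_cast hm.le)

theorem lintegral_natCast_eq_tsum {Ω : Type*} [MeasurableSpace Ω] (μ : Measure Ω) {τ : Ω → ℕ}
    (hτ : Measurable τ) : ∫⁻ ω, (τ ω : ℝ≥0∞) ∂μ = ∑' n : ℕ, μ {ω | n < τ ω} := by
  have hmeas (n : ℕ) : MeasurableSet {ω | n < τ ω} := hτ measurableSet_Ioi
  have hcount (ω : Ω) : (τ ω : ℝ≥0∞) = ∑' n : ℕ, {ω | n < τ ω}.indicator 1 ω := by
    rw [tsum_eq_sum (s := Finset.range (τ ω)) (by simp)]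
    simp [Set.indicator_apply, Finset.sum_ite_of_true fun _ => Finset.mem_range.1]
  simp_rw [hcount]
  rw [lintegral_tsum fun n => (measurable_one.indicator (hmeas n)).aemeasurable]
  exact tsum_congr fun n => lintegral_indicator_one (hmeas n)

theorem lintegral_natCast_le_ofReal_iff {Ω : Type*} [MeasurableSpace Ω] {μ : Measure Ω}
    [IsFiniteMeasure μ] {τ : Ω → ℕ} (hτ : Measurable τ) {L : ℝ} (hL : 0 ≤ L) :
    ∫⁻ ω, (τ ω : ℝ≥0∞) ∂μ ≤ ENNReal.ofReal L ↔
      ∀ N, ∑ n ∈ Finset.range N, μ.real {ω | n < τ ω} ≤ L := by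
  rw [lintegral_natCast_eq_tsum μ hτ, ENNReal.tsum_eq_iSup_nat, iSup_le_iff]
  refine forall_congr' fun N => ?_
  rw [← ENNReal.ofReal_le_ofReal_iff hL, ENNReal.ofReal_sum_of_nonneg fun _ _ => measureReal_nonneg]
  simp only [ofReal_measureReal (measure_ne_top _ _)]

theorem measurable_of_isStoppingTime {Ω : Type*} {m : MeasurableSpace Ω} {f : Filtration ℕ m}
    {τ : Ω → ℕ} (hτ : IsStoppingTime f fun ω => (τ ω : WithTop ℕ)) : Measurable τ :=
  measurable_of_Ioi fun n => by
    simpa [Set.preimage, Set.mem_Ioi] using f.le n _ (hτ.measurableSet_gt n)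

theorem ae_measure_preimage_singleton_ne_zero {Ω β : Type*} [MeasurableSpace Ω] [Countable β]
    (μ : Measure Ω) (X : Ω → β) : ∀ᵐ ω ∂μ, μ (X ⁻¹' {X ω}) ≠ 0 := by
  have hnull : μ (⋃ x ∈ {x | μ (X ⁻¹' {x}) = 0}, X ⁻¹' {x}) = 0 :=
    (measure_biUnion_null_iff (Set.to_countable _)).2 fun _ => id
  filter_upwards [measure_eq_zero_iff_ae_notMem.1 hnull] with ω hω h
  exact hω (by simpa using h)

theorem integral_comp_eq_sum {Ω β : Type*} [MeasurableSpace Ω] {μ : Measure Ω} [IsFiniteMeasure μ]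
    [Fintype β] [MeasurableSpace β] [DiscreteMeasurableSpace β] {X : Ω → β} (hX : Measurable X)
    (F : β → ℝ) : ∫ ω, F (X ω) ∂μ = ∑ x, μ.real (X ⁻¹' {x}) * F x := by
  rw [← integral_map hX.aemeasurable (Measurable.of_discrete (f := F)).aestronglyMeasurable,
    integral_fintype .of_finite]
  simp [map_measureReal_apply hX (measurableSet_singleton _)]

theorem sum_fin_succ_eq_sum_snoc {α β : Type*} [Fintype α] [AddCommMonoid β] {n : ℕ}
    (F : (Fin (n + 1) → α) → β) : ∑ y, F y = ∑ y : Fin n → α, ∑ b, F (Fin.snoc y b) := by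
  rw [← (Fin.snocEquiv fun _ => α).sum_comp, Fintype.sum_prod_type_right]
  rfl

instance BECOutput.instDiscreteMeasurableSpace : DiscreteMeasurableSpace BECOutput :=
  ⟨fun _ => trivial⟩

section Survivors

variable {α : Type*}

/-- The probability with which the channel output takes the value `b` for an input that is
consistent with `b`. -/
def becWeight (δ : ℝ) : BECOutput → ℝ
  | none => δ
  | some _ => 1 - δ

/-- The messages in `A` that remain possible when the channel, whose input for the message `w` is
`x w`, produces the given output. -/
def narrow (A : Finset α) (x : α → Bool) : BECOutput → Finset α
  | none => A
  | some b => {w ∈ A | x w = b}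

theorem ite_mem_mul_becTransition [DecidableEq α] (δ c : ℝ) (A : Finset α) (x : α → Bool)
    (b : BECOutput) (w : α) :
    (if w ∈ A then c else 0) * becTransition δ (x w) b =
      if w ∈ narrow A x b then c * becWeight δ b else 0 := by
  cases b <;> simp only [narrow, becTransition, becWeight, Finset.mem_filter] <;> grind

theorem card_narrow_false_add_card_narrow_true (A : Finset α) (x : α → Bool) :
    (narrow A x (some false)).card + (narrow A x (some true)).card = A.card := by
  simpa [narrow] using Finset.card_filter_add_card_filter_not (s := A) (fun w => x w = false)

theorem sum_becWeight_mul (δ : ℝ) (F : BECOutput → ℝ) :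
    ∑ b, becWeight δ b * F b = δ * F none + (1 - δ) * (F (some false) + F (some true)) := by
  simp only [Fintype.sum_option, Fintype.sum_bool, becWeight]
  ring

theorem totalLength_card_le {δ : ℝ} (hδ : δ ≤ 1) (A : Finset α) (x : α → Bool) :
    totalLength A.card ≤ ∑ b, becWeight δ b * totalLength (narrow A x b).card +
      (1 - δ) * (A.card * if 2 ≤ A.card then 1 else 0) := by
  have hcard := card_narrow_false_add_card_narrow_true A x
  have h_split : totalLength A.card ≤ totalLength (narrow A x (some false)).card +
      totalLength (narrow A x (some true)).card + A.card * if 2 ≤ A.card then 1 else 0 := by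
    split_ifs with h
    · rw [← hcard, mul_one]
      push_cast
      exact totalLength_add_le (Nat.cast_nonneg _) (Nat.cast_nonneg _)
    · rw [totalLength_natCast_of_le_one (by lia), totalLength_natCast_of_le_one (by lia),
        totalLength_natCast_of_le_one (by lia)]
      simp
  rw [sum_becWeight_mul, narrow]
  linarith [mul_le_mul_of_nonneg_left h_split (sub_nonneg.2 hδ)]

theorem totalLength_card_eq (δ : ℝ) {A : Finset α} {x : α → Bool}
    (hx : (narrow A x (some false)).card = A.card / 2) :
    totalLength A.card = ∑ b, becWeight δ b * totalLength (narrow A x b).card +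
      (1 - δ) * (A.card * if 2 ≤ A.card then 1 else 0) := by
  have hcard := card_narrow_false_add_card_narrow_true A x
  have h_split : totalLength A.card = totalLength (narrow A x (some false)).card +
      totalLength (narrow A x (some true)).card + A.card * if 2 ≤ A.card then 1 else 0 := by
    split_ifs with h
    · rw [hx, show (narrow A x (some true)).card = A.card - A.card / 2 by lia, mul_one]
      exact totalLength_natCast_half h
    · rw [totalLength_natCast_of_le_one (by lia), totalLength_natCast_of_le_one (by lia),
        totalLength_natCast_of_le_one (by lia)]
      simp
  rw [sum_becWeight_mul, narrow]
  linear_combination (1 - δ) * h_split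

/-- The encoders of a feedback code without common randomness: `f n w y` is the channel input at
time `n + 1` for the message `w` when the first `n` outputs are `y`. -/
abbrev FeedbackEncoder (α : Type*) : Type _ := (n : ℕ) → α → (Fin n → BECOutput) → Bool

/-- The messages consistent with the first `n` channel outputs when the encoder `f` is used. -/
def survivors [Fintype α] (f : FeedbackEncoder α) : (n : ℕ) → (Fin n → BECOutput) → Finset α
  | 0, _ => Finset.univ
  | n + 1, y => narrow (survivors f n (Fin.init y)) (f n · (Fin.init y)) (y (Fin.last n))

theorem survivors_snoc [Fintype α] (f : FeedbackEncoder α) (n : ℕ) (y : Fin n → BECOutput)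
    (b : BECOutput) :
    survivors f (n + 1) (Fin.snoc y b) = narrow (survivors f n y) (f n · y) b := by
  simp [survivors]

/-- Every input of the encoder `f` splits the messages that are still possible into two halves. -/
def IsHalving [Fintype α] (f : FeedbackEncoder α) : Prop :=
  ∀ n y, (narrow (survivors f n y) (f n · y) (some false)).card = (survivors f n y).card / 2

end Survivors

section History

variable {Ω S : Type*}

/-- What the decoder has observed by time `n`: the common randomness and the first `n` channel
outputs. -/
def history (U : Ω → S) (Y : ℕ → Ω → BECOutput) (n : ℕ) (ω : Ω) : S × (Fin n → BECOutput) :=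
  (U ω, fun k => Y k ω)

theorem history_eq_iff {U : Ω → S} {Y : ℕ → Ω → BECOutput} {n : ℕ} {ω : Ω} {u : S}
    {y : Fin n → BECOutput} :
    history U Y n ω = (u, y) ↔ U ω = u ∧ ∀ k : Fin n, Y k ω = y k := by
  simp [history, funext_iff]

theorem measurable_history [MeasurableSpace Ω] [MeasurableSpace S] {U : Ω → S}
    {Y : ℕ → Ω → BECOutput} (hU : Measurable U) (hY : ∀ k, Measurable (Y k)) (n : ℕ) :
    Measurable (history U Y n) :=
  hU.prodMk (measurable_pi_lambda _ fun k => hY k)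

theorem feedbackFiltration_eq_comap_history {Ω S : Type} [MeasurableSpace Ω]
    [mS : MeasurableSpace S] {U : Ω → S} {Y : ℕ → Ω → BECOutput} (hU : Measurable U)
    (hY : ∀ k, Measurable (Y k)) (n : ℕ) :
    feedbackFiltration U Y hU hY n = MeasurableSpace.comap (history U Y n) inferInstance := by
  change MeasurableSpace.comap U mS ⊔ ⨆ k : ℕ, ⨆ _ : k < n, MeasurableSpace.comap (Y k) _ =
    MeasurableSpace.comap (fun ω => (U ω, fun k : Fin n => Y k ω)) (mS.prod MeasurableSpace.pi)
  rw [MeasurableSpace.comap_prodMk, MeasurableSpace.comap_process_pi, iSup_subtype',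
    ← Fin.equivSubtype.iSup_comp]
  rfl

end History

section Transmission

variable {Ω S α : Type*} [MeasurableSpace Ω] [Fintype α]

/-- The number of messages consistent with the history `x` when, for each value of the common
randomness, the encoder `enc` is used. -/
def ambiguity (enc : S → FeedbackEncoder α) {n : ℕ} (x : S × (Fin n → BECOutput)) : ℕ :=
  (survivors (enc x.1) n x.2).card

/-- The probability that the history is `x` and the message is `w`, for every message `w`
consistent with `x`. -/
noncomputable def survivorMass (α : Type*) [Fintype α] (δ : ℝ) (μ : Measure Ω) (U : Ω → S) {n : ℕ}
    (x : S × (Fin n → BECOutput)) : ℝ :=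
  μ.real {ω | U ω = x.1} / Fintype.card α * ∏ k, becWeight δ (x.2 k)

theorem survivorMass_snoc (δ : ℝ) (μ : Measure Ω) (U : Ω → S) {n : ℕ} (u : S)
    (y : Fin n → BECOutput) (b : BECOutput) :
    survivorMass α δ μ U (u, (Fin.snoc y b : Fin (n + 1) → BECOutput)) =
      survivorMass α δ μ U (u, y) * becWeight δ b := by
  simp [survivorMass, Fin.prod_univ_castSucc, mul_assoc]

theorem survivorMass_nonneg {δ : ℝ} (hδ0 : 0 ≤ δ) (hδ1 : δ ≤ 1) (μ : Measure Ω) (U : Ω → S) {n : ℕ}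
    (x : S × (Fin n → BECOutput)) : 0 ≤ survivorMass α δ μ U x := by
  have h_weight (b : BECOutput) : 0 ≤ becWeight δ b := by
    cases b
    exacts [hδ0, sub_nonneg.2 hδ1]
  exact mul_nonneg (by positivity) (Finset.prod_nonneg fun k _ => h_weight (x.2 k))

variable [MeasurableSpace S] [MeasurableSpace α]

/-- A uniformly distributed message `W`, independent of the common randomness `U`, is sent over
the binary erasure channel with the feedback encoders `enc u`, `u : S`, producing the outputs
`Y`. As in `VLFCode`, `Y n` is the output at time `n + 1`. -/
structure IsBECTransmission (δ : ℝ) (μ : Measure Ω) (enc : S → FeedbackEncoder α) (U : Ω → S)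
    (W : Ω → α) (Y : ℕ → Ω → BECOutput) : Prop where
  measurable_U : Measurable U
  measurable_W : Measurable W
  measurable_Y : ∀ n, Measurable (Y n)
  uniform_W : ∀ w, μ.real {ω | W ω = w} = 1 / Fintype.card α
  indep_U_W : IndepFun U W μ
  channel : ∀ (n : ℕ) (u : S) (w : α) (y : Fin n → BECOutput) (b : BECOutput),
    μ.real {ω | U ω = u ∧ W ω = w ∧ (∀ k : Fin n, Y k ω = y k) ∧ Y n ω = b} =
      μ.real {ω | U ω = u ∧ W ω = w ∧ ∀ k : Fin n, Y k ω = y k} *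
        becTransition δ (enc u n w y) b

namespace IsBECTransmission

variable {δ : ℝ} {μ : Measure Ω} {enc : S → FeedbackEncoder α} {U : Ω → S} {W : Ω → α}
  {Y : ℕ → Ω → BECOutput}

theorem measurable_history (h : IsBECTransmission δ μ enc U W Y) (n : ℕ) :
    Measurable (history U Y n) :=
  _root_.measurable_history h.measurable_U h.measurable_Y n

variable [MeasurableSingletonClass S] [MeasurableSingletonClass α]

theorem measureReal_history_eq [DecidableEq α] (h : IsBECTransmission δ μ enc U W Y) (n : ℕ)
    (u : S) (w : α) (y : Fin n → BECOutput) :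
    μ.real {ω | U ω = u ∧ W ω = w ∧ ∀ k : Fin n, Y k ω = y k} =
      if w ∈ survivors (enc u) n y then survivorMass α δ μ U (u, y) else 0 := by
  induction n with
  | zero =>
    have h_indep := h.indep_U_W.measure_inter_preimage_eq_mul {u} {w} (.singleton u) (.singleton w)
    have h_real : μ.real {ω | U ω = u ∧ W ω = w} = μ.real {ω | U ω = u} * μ.real {ω | W ω = w} := by
      simpa [measureReal_def, Set.preimage, Set.inter_def] using congrArg ENNReal.toReal h_indep
    simp [survivors, survivorMass, h_real, h.uniform_W, div_eq_mul_inv]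
  | succ n ih =>
    obtain ⟨y, b, rfl⟩ : ∃ y' b, y = Fin.snoc y' b := ⟨_, _, (Fin.snoc_init_self y).symm⟩
    rw [survivors_snoc, survivorMass_snoc, ← ite_mem_mul_becTransition, ← ih, ← h.channel]
    simp [Fin.forall_fin_succ']

theorem measureReal_history_message_preimage [DecidableEq α]
    (h : IsBECTransmission δ μ enc U W Y) (n : ℕ) (x : S × (Fin n → BECOutput)) (w : α) :
    μ.real ((fun ω => (history U Y n ω, W ω)) ⁻¹' {(x, w)}) =
      if w ∈ survivors (enc x.1) n x.2 then survivorMass α δ μ U x else 0 := by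
  obtain ⟨u, y⟩ := x
  rw [← h.measureReal_history_eq]
  congr with ω
  simp only [Set.mem_preimage, Set.mem_singleton_iff, Set.mem_ofPred_eq, Prod.mk.injEq,
    history_eq_iff]
  tauto

theorem integral_comp_history [IsFiniteMeasure μ] [Fintype S]
    (h : IsBECTransmission δ μ enc U W Y) (n : ℕ) (F : S × (Fin n → BECOutput) → ℝ) :
    ∫ ω, F (history U Y n ω) ∂μ = ∑ x, survivorMass α δ μ U x * (ambiguity enc x * F x) := by
  classical
  rw [integral_comp_eq_sum ((h.measurable_history n).prodMk h.measurable_W) fun p => F p.1,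
    Fintype.sum_prod_type]
  refine Finset.sum_congr rfl fun x _ => ?_
  simp only [h.measureReal_history_message_preimage, ← Finset.sum_mul, Finset.sum_ite_mem,
    Finset.univ_inter, Finset.sum_const, nsmul_eq_mul, ambiguity]
  ring

theorem measureReal_comp_history [IsFiniteMeasure μ] [Fintype S]
    (h : IsBECTransmission δ μ enc U W Y) (n : ℕ) (p : S × (Fin n → BECOutput) → Prop)
    [DecidablePred p] :
    μ.real {ω | p (history U Y n ω)} =
      ∑ x, survivorMass α δ μ U x * (ambiguity enc x * if p x then 1 else 0) := by
  have h_meas : MeasurableSet {ω | p (history U Y n ω)} :=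
    h.measurable_history n (.of_discrete (s := {x | p x}))
  rw [← h.integral_comp_history n fun x => if p x then 1 else 0, ← integral_indicator_one h_meas]
  simp only [Set.indicator_apply, Set.mem_ofPred_eq, Pi.one_apply]

theorem integral_lstar_ambiguity_succ [IsFiniteMeasure μ] [Fintype S]
    (h : IsBECTransmission δ μ enc U W Y) (n : ℕ) :
    ∫ ω, lstar (ambiguity enc (history U Y (n + 1) ω)) ∂μ =
      ∑ x : S × (Fin n → BECOutput), survivorMass α δ μ U x * ∑ b, becWeight δ b *
        totalLength (narrow (survivors (enc x.1) n x.2) (enc x.1 n · x.2) b).card := by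
  rw [h.integral_comp_history (n + 1) fun x => lstar (ambiguity enc x), Fintype.sum_prod_type,
    Fintype.sum_prod_type]
  refine Finset.sum_congr rfl fun u _ => ?_
  rw [sum_fin_succ_eq_sum_snoc]
  simp only [survivorMass_snoc, Finset.mul_sum, ambiguity, survivors_snoc, totalLength, mul_assoc]

theorem integral_lstar_ambiguity_succ_add [IsFiniteMeasure μ] [Fintype S]
    (h : IsBECTransmission δ μ enc U W Y) (n : ℕ) :
    ∫ ω, lstar (ambiguity enc (history U Y (n + 1) ω)) ∂μ +
        (1 - δ) * μ.real {ω | 2 ≤ ambiguity enc (history U Y n ω)} =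
      ∑ x : S × (Fin n → BECOutput), survivorMass α δ μ U x * (∑ b, becWeight δ b *
        totalLength (narrow (survivors (enc x.1) n x.2) (enc x.1 n · x.2) b).card +
          (1 - δ) * (ambiguity enc x * if 2 ≤ ambiguity enc x then 1 else 0)) := by
  rw [h.integral_lstar_ambiguity_succ, h.measureReal_comp_history n fun x => 2 ≤ ambiguity enc x,
    Finset.mul_sum, ← Finset.sum_add_distrib]
  exact Finset.sum_congr rfl fun x _ => by ring

theorem integral_lstar_ambiguity_le_succ [IsFiniteMeasure μ] [Finite S]
    (h : IsBECTransmission δ μ enc U W Y) (hδ0 : 0 ≤ δ) (hδ1 : δ ≤ 1) (n : ℕ) :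
    ∫ ω, lstar (ambiguity enc (history U Y n ω)) ∂μ ≤
      ∫ ω, lstar (ambiguity enc (history U Y (n + 1) ω)) ∂μ +
        (1 - δ) * μ.real {ω | 2 ≤ ambiguity enc (history U Y n ω)} := by
  cases nonempty_fintype S
  rw [h.integral_comp_history n fun x => lstar (ambiguity enc x),
    h.integral_lstar_ambiguity_succ_add]
  exact Finset.sum_le_sum fun x _ =>
    mul_le_mul_of_nonneg_left (totalLength_card_le hδ1 _ _) (survivorMass_nonneg hδ0 hδ1 μ U x)

theorem integral_lstar_ambiguity_eq_succ [IsFiniteMeasure μ] [Finite S]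
    (h : IsBECTransmission δ μ enc U W Y) (h_halving : ∀ u, IsHalving (enc u)) (n : ℕ) :
    ∫ ω, lstar (ambiguity enc (history U Y n ω)) ∂μ =
      ∫ ω, lstar (ambiguity enc (history U Y (n + 1) ω)) ∂μ +
        (1 - δ) * μ.real {ω | 2 ≤ ambiguity enc (history U Y n ω)} := by
  cases nonempty_fintype S
  rw [h.integral_comp_history n fun x => lstar (ambiguity enc x),
    h.integral_lstar_ambiguity_succ_add]
  exact Finset.sum_congr rfl fun x _ =>
    congrArg (_ * ·) (totalLength_card_eq δ (h_halving x.1 n x.2))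

theorem lstar_card_le [IsProbabilityMeasure μ] [Finite S]
    (h : IsBECTransmission δ μ enc U W Y) (hδ0 : 0 ≤ δ) (hδ1 : δ ≤ 1) (n : ℕ) :
    lstar (Fintype.card α) ≤ ∫ ω, lstar (ambiguity enc (history U Y n ω)) ∂μ +
      (1 - δ) * ∑ k ∈ Finset.range n, μ.real {ω | 2 ≤ ambiguity enc (history U Y k ω)} := by
  induction n with
  | zero => simp [ambiguity, survivors]
  | succ n ih =>
    rw [Finset.sum_range_succ]
    linarith [h.integral_lstar_ambiguity_le_succ hδ0 hδ1 n]

theorem lstar_card_eq [IsProbabilityMeasure μ] [Finite S]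
    (h : IsBECTransmission δ μ enc U W Y) (h_halving : ∀ u, IsHalving (enc u)) (n : ℕ) :
    lstar (Fintype.card α) = ∫ ω, lstar (ambiguity enc (history U Y n ω)) ∂μ +
      (1 - δ) * ∑ k ∈ Finset.range n, μ.real {ω | 2 ≤ ambiguity enc (history U Y k ω)} := by
  induction n with
  | zero => simp [ambiguity, survivors]
  | succ n ih =>
    rw [Finset.sum_range_succ]
    linarith [h.integral_lstar_ambiguity_eq_succ h_halving n]

theorem integral_lstar_ambiguity_le [IsFiniteMeasure μ] [Finite S]
    (h : IsBECTransmission δ μ enc U W Y) (hδ0 : 0 ≤ δ) (hδ1 : δ ≤ 1) (n : ℕ) :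
    ∫ ω, lstar (ambiguity enc (history U Y n ω)) ∂μ ≤
      lstar (Fintype.card α) * μ.real {ω | 2 ≤ ambiguity enc (history U Y n ω)} := by
  cases nonempty_fintype S
  rw [h.integral_comp_history n fun x => lstar (ambiguity enc x),
    h.measureReal_comp_history n fun x => 2 ≤ ambiguity enc x, Finset.mul_sum]
  refine Finset.sum_le_sum fun x _ => ?_
  rw [mul_left_comm (lstar _), mul_left_comm (lstar _)]
  have h_card : ambiguity enc x ≤ Fintype.card α := Finset.card_le_univ _
  have h_mass := survivorMass_nonneg (α := α) hδ0 hδ1 μ U x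
  gcongr
  exact lstar_natCast_le_mul_ite h_card

theorem ae_mem_survivors [IsFiniteMeasure μ] [Finite S] (h : IsBECTransmission δ μ enc U W Y)
    (n : ℕ) : ∀ᵐ ω ∂μ, W ω ∈ survivors (enc (U ω)) n (history U Y n ω).2 ∧
      survivorMass α δ μ U (history U Y n ω) ≠ 0 := by
  classical
  filter_upwards [ae_measure_preimage_singleton_ne_zero μ fun ω => (history U Y n ω, W ω)] with ω hω
  rw [← measureReal_ne_zero_iff, h.measureReal_history_message_preimage] at hω
  exact ite_ne_right_iff.1 hω

theorem exists_history_eq_of_mem_survivors [IsFiniteMeasure μ]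
    (h : IsBECTransmission δ μ enc U W Y) {n : ℕ} {x : S × (Fin n → BECOutput)} {w : α}
    (hx : survivorMass α δ μ U x ≠ 0) (hw : w ∈ survivors (enc x.1) n x.2) {p : Ω → Prop}
    (hp : ∀ᵐ ω ∂μ, p ω) : ∃ ω, history U Y n ω = x ∧ W ω = w ∧ p ω := by
  classical
  have h_pos : μ ((fun ω => (history U Y n ω, W ω)) ⁻¹' {(x, w)}) ≠ 0 := by
    rwa [← measureReal_ne_zero_iff, h.measureReal_history_message_preimage, if_pos hw]
  obtain ⟨ω, hω, hpω⟩ := ((frequently_ae_mem_iff.2 h_pos).and_eventually hp).exists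
  obtain ⟨h_history, h_message⟩ := Prod.mk.inj hω
  exact ⟨ω, h_history, h_message, hpω⟩

end IsBECTransmission

end Transmission

namespace VLFCode

attribute [instance] fintypeS measurableSpaceS discreteS measurableSpaceΩ isProbabilityMeasure

variable {δ L ε : ℝ} {M : ℕ}

/-- The encoders of a code, as a family of encoders indexed by the common randomness. -/
def encoder (C : VLFCode δ L M ε) (u : C.S) : FeedbackEncoder (Fin M) := fun n => C.enc n u

/-- What the decoder of a code has observed by time `n`. -/
abbrev observation (C : VLFCode δ L M ε) (n : ℕ) : C.Ω → C.S × (Fin n → BECOutput) :=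
  history C.U C.Y n

/-- The final estimate of the message. -/
def estimate (C : VLFCode δ L M ε) (ω : C.Ω) : Fin M := C.dec (C.τ ω) (C.U ω) fun k => C.Y k ω

theorem isBECTransmission (C : VLFCode δ L M ε) :
    IsBECTransmission δ C.μ C.encoder C.U C.W C.Y where
  measurable_U := C.measurable_U
  measurable_W := C.measurable_W
  measurable_Y := C.measurable_Y
  uniform_W := by simpa using C.uniform_W
  indep_U_W := C.indep_U_W
  channel := C.channel

theorem τ_eq_of_observation_eq (C : VLFCode δ L M ε) {n : ℕ} {ω ω' : C.Ω}
    (h : C.observation n ω = C.observation n ω') (hn : C.τ ω ≤ n) : C.τ ω = C.τ ω' := by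
  have h_meas := C.isStoppingTime.measurableSet_eq_le (i := C.τ ω) (j := n) (by exact_mod_cast hn)
  rw [feedbackFiltration_eq_comap_history] at h_meas
  obtain ⟨s, -, hs⟩ := h_meas
  have h_mem (ω'' : C.Ω) : history C.U C.Y n ω'' ∈ s ↔ C.τ ω'' = C.τ ω := by
    simpa using Set.ext_iff.1 hs ω''
  exact ((h_mem ω').1 (h.subst (motive := (· ∈ s)) ((h_mem ω).2 rfl))).symm

theorem estimate_eq_of_observation_eq (C : VLFCode δ L M ε) {n : ℕ} {ω ω' : C.Ω}
    (h : C.observation n ω = C.observation n ω') (hn : C.τ ω ≤ n) :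
    C.estimate ω = C.estimate ω' := by
  have hU : C.U ω = C.U ω' := congrArg Prod.fst h
  have hY (k : Fin (C.τ ω)) : C.Y k ω = C.Y k ω' :=
    congrFun (congrArg Prod.snd h) (k.castLE hn)
  rw [estimate, estimate, ← C.τ_eq_of_observation_eq h hn, hU, funext hY]

theorem ae_estimate_eq (C : VLFCode δ L M 0) : ∀ᵐ ω ∂C.μ, C.estimate ω = C.W ω := by
  rw [ae_iff, ← measureReal_eq_zero_iff]
  exact C.error_le.antisymm measureReal_nonneg

theorem ae_ambiguity_le_one (C : VLFCode δ L M 0) (n : ℕ) :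
    ∀ᵐ ω ∂C.μ, C.τ ω ≤ n → ambiguity C.encoder (C.observation n ω) ≤ 1 := by
  filter_upwards [C.isBECTransmission.ae_mem_survivors n] with ω hω hτ
  have h_estimate (w) (hw : w ∈ survivors (C.encoder (C.U ω)) n (C.observation n ω).2) :
      w = C.estimate ω := by
    obtain ⟨ω', h_obs, rfl, h_correct⟩ :=
      C.isBECTransmission.exists_history_eq_of_mem_survivors hω.2 hw C.ae_estimate_eq
    rw [← h_correct, C.estimate_eq_of_observation_eq h_obs.symm hτ]
  exact Finset.card_le_one.2 fun w hw w' hw' => (h_estimate w hw).trans (h_estimate w' hw').symm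

theorem measureReal_two_le_ambiguity_le (C : VLFCode δ L M 0) (n : ℕ) :
    C.μ.real {ω | 2 ≤ ambiguity C.encoder (C.observation n ω)} ≤ C.μ.real {ω | n < C.τ ω} := by
  refine ENNReal.toReal_mono (measure_ne_top _ _) (measure_mono_ae ?_)
  filter_upwards [C.ae_ambiguity_le_one n] with ω hω h_two
  exact not_le.1 fun hτ => (hω hτ).not_gt h_two

theorem sum_measureReal_lt_τ_le (C : VLFCode δ L M ε) (N : ℕ) :
    ∑ n ∈ Finset.range N, C.μ.real {ω | n < C.τ ω} ≤ L :=
  (lintegral_natCast_le_ofReal_iff (measurable_of_isStoppingTime C.isStoppingTime) C.L_nonneg).1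
    C.expectation_le N

theorem lstar_le_mul_measureReal_add (C : VLFCode δ L M 0) (hδ0 : 0 ≤ δ) (hδ1 : δ ≤ 1) (n : ℕ) :
    lstar M ≤ lstar M * C.μ.real {ω | n < C.τ ω} + (1 - δ) * L := by
  calc
    lstar M ≤ ∫ ω, lstar (ambiguity C.encoder (C.observation n ω)) ∂C.μ + (1 - δ) *
        ∑ k ∈ Finset.range n, C.μ.real {ω | 2 ≤ ambiguity C.encoder (C.observation k ω)} := by
      simpa using C.isBECTransmission.lstar_card_le hδ0 hδ1 n
    _ ≤ lstar M * C.μ.real {ω | 2 ≤ ambiguity C.encoder (C.observation n ω)} + (1 - δ) *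
        ∑ k ∈ Finset.range n, C.μ.real {ω | 2 ≤ ambiguity C.encoder (C.observation k ω)} := by
      gcongr
      simpa using C.isBECTransmission.integral_lstar_ambiguity_le hδ0 hδ1 n
    _ ≤ lstar M * C.μ.real {ω | n < C.τ ω} +
        (1 - δ) * ∑ k ∈ Finset.range n, C.μ.real {ω | k < C.τ ω} := by
      exact add_le_add
        (mul_le_mul_of_nonneg_left (C.measureReal_two_le_ambiguity_le n) (lstar_natCast_nonneg M))
        (mul_le_mul_of_nonneg_left
          (Finset.sum_le_sum fun k _ => C.measureReal_two_le_ambiguity_le k) (sub_nonneg.2 hδ1))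
    _ ≤ lstar M * C.μ.real {ω | n < C.τ ω} + (1 - δ) * L := by
      gcongr
      exact C.sum_measureReal_lt_τ_le n

theorem lstar_div_le (C : VLFCode δ L M 0) (hδ0 : 0 ≤ δ) (hδ1 : δ < 1) :
    lstar M / (1 - δ) ≤ L := by
  have h_tail : Filter.Tendsto (fun n : ℕ => C.μ.real {ω | n < C.τ ω}) Filter.atTop (nhds 0) :=
    (summable_of_sum_range_le (fun _ => measureReal_nonneg)
      C.sum_measureReal_lt_τ_le).tendsto_atTop_zero
  have h_limit := (h_tail.const_mul (lstar M)).add_const ((1 - δ) * L)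
  rw [mul_zero, zero_add] at h_limit
  rw [div_le_iff₀' (sub_pos.2 hδ1)]
  exact ge_of_tendsto' h_limit (C.lstar_le_mul_measureReal_add hδ0 hδ1.le)

end VLFCode

section Bisection

variable {α : Type*}

theorem exists_card_narrow_false_eq_half (A : Finset α) :
    ∃ x : α → Bool, (narrow A x (some false)).card = A.card / 2 := by
  classical
  obtain ⟨B, hBA, hB⟩ := Finset.exists_subset_card_eq (Nat.div_le_self A.card 2)
  refine ⟨fun w => decide (w ∉ B), ?_⟩
  simpa [narrow, Finset.filter_mem_eq_inter, Finset.inter_eq_right.2 hBA] using hB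

variable [Fintype α]

/-- The messages that remain possible after the first `n` outputs if, whenever these messages form
the set `A`, the message `w` is encoded as `x A w`. -/
def querySet (x : Finset α → α → Bool) : (n : ℕ) → (Fin n → BECOutput) → Finset α
  | 0, _ => Finset.univ
  | n + 1, y =>
    narrow (querySet x n (Fin.init y)) (x (querySet x n (Fin.init y))) (y (Fin.last n))

/-- The encoder that encodes the message `w` as `x A w` whenever `A` is the set of the messages
that are still possible. -/
def queryEncoder (x : Finset α → α → Bool) : FeedbackEncoder α := fun n w y => x (querySet x n y) w

theorem survivors_queryEncoder (x : Finset α → α → Bool) (n : ℕ) (y : Fin n → BECOutput) :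
    survivors (queryEncoder x) n y = querySet x n y := by
  induction n with
  | zero => rfl
  | succ n ih =>
    rw [survivors, ih, querySet]
    rfl

theorem exists_isHalving (α : Type*) [Fintype α] : ∃ f : FeedbackEncoder α, IsHalving f := by
  choose x hx using exists_card_narrow_false_eq_half (α := α)
  refine ⟨queryEncoder x, fun n y => ?_⟩
  rw [survivors_queryEncoder]
  exact hx (querySet x n y)

end Bisection

section Construction

/-- The channel output for the input `x`, where `e` tells whether an erasure occurs. -/
def eraseIf (e x : Bool) : BECOutput := if e then none else some x

variable {α : Type*}

/-- The channel outputs when the message `w` is sent with the encoder `f` and `e n` tells whether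
the output at time `n + 1` is erased. -/
def channelOutput (f : FeedbackEncoder α) (w : α) (e : ℕ → Bool) (n : ℕ) : BECOutput :=
  eraseIf (e n) (f n w fun k => channelOutput f w e k)
termination_by n
decreasing_by exact k.2

theorem forall_channelOutput_eq_iff (f : FeedbackEncoder α) (w : α) (e : ℕ → Bool)
    (z : ℕ → BECOutput) (n : ℕ) :
    (∀ k < n, channelOutput f w e k = z k) ↔
      ∀ k < n, eraseIf (e k) (f k w fun j => z j) = z k := by
  induction n with
  | zero => simp
  | succ n ih =>
    rw [Nat.forall_lt_succ_right, Nat.forall_lt_succ_right, ← ih]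
    refine and_congr_right fun h => ?_
    rw [channelOutput, funext fun k : Fin n => h k k.2]

theorem exists_extension {β : Type*} {n : ℕ} (y : Fin n → β) (b : β) :
    ∃ z : ℕ → β, y = (fun k : Fin n => z k) ∧ b = z n :=
  ⟨fun k => if h : k < n then y ⟨k, h⟩ else b, by ext; simp, by simp⟩

theorem bernoulliMeasure_real_eraseIf_eq (p : unitInterval) (x : Bool) (b : BECOutput) :
    (bernoulliMeasure true false p).real {e | eraseIf e x = b} = becTransition p x b := by
  classical
  rw [bernoulliMeasure_real_apply p .of_discrete]
  cases b <;> simp [eraseIf, becTransition, eq_comm]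

/-- The law of a uniformly distributed message and of independent erasures of probability `p`. -/
noncomputable def messageErasureMeasure (α : Type*) [MeasurableSpace α] (p : unitInterval) :
    Measure (α × (ℕ → Bool)) :=
  (uniformOn Set.univ).prod (Measure.infinitePi fun _ => bernoulliMeasure true false p)

variable [MeasurableSpace α] [MeasurableSingletonClass α]

instance messageErasureMeasure.instIsProbabilityMeasure [Finite α] [Nonempty α]
    (p : unitInterval) : IsProbabilityMeasure (messageErasureMeasure α p) := by
  unfold messageErasureMeasure
  infer_instance

theorem measurable_channelOutput [Finite α] (f : FeedbackEncoder α) (n : ℕ) :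
    Measurable fun ω : α × (ℕ → Bool) => channelOutput f ω.1 ω.2 n := by
  induction n using Nat.strong_induction_on with
  | _ n ih =>
    have h_past : Measurable fun ω : α × (ℕ → Bool) => fun k : Fin n => channelOutput f ω.1 ω.2 k :=
      measurable_pi_lambda _ fun k => ih k k.2
    have h_erasure : Measurable fun ω : α × (ℕ → Bool) => ω.2 n :=
      (measurable_pi_apply n).comp measurable_snd
    have h_step : Measurable fun q : Bool × α × (Fin n → BECOutput) =>
      eraseIf q.1 (f n q.2.1 q.2.2) := .of_discrete
    have h := h_step.comp (h_erasure.prodMk (measurable_fst.prodMk h_past))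
    convert h using 2 with ω
    rw [channelOutput]
    rfl

variable [Fintype α]

theorem messageErasureMeasure_real_eq (p : unitInterval) (f : FeedbackEncoder α)
    (n : ℕ) (w : α) (z : ℕ → BECOutput) :
    (messageErasureMeasure α p).real {ω | ω.1 = w ∧ ∀ k < n, channelOutput f ω.1 ω.2 k = z k} =
      1 / Fintype.card α *
        ∏ k ∈ Finset.range n, becTransition p (f k w fun j => z j) (z k) := by
  have h_event : {ω : α × (ℕ → Bool) | ω.1 = w ∧ ∀ k < n, channelOutput f ω.1 ω.2 k = z k} =
      {w} ×ˢ Set.pi (Finset.range n) fun k => {e | eraseIf e (f k w fun j => z j) = z k} := by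
    ext ⟨v, e⟩
    simp only [Set.mem_ofPred_eq, Set.mem_prod, Set.mem_singleton_iff, Set.mem_pi,
      Finset.coe_range, Set.mem_Iio]
    refine and_congr_right ?_
    rintro rfl
    exact forall_channelOutput_eq_iff f v e z n
  rw [h_event, messageErasureMeasure, measureReal_prod_prod, measureReal_def (Measure.infinitePi _),
    Measure.infinitePi_pi _ fun _ _ => .of_discrete, ENNReal.toReal_prod]
  congr 1
  · simp [measureReal_def, uniformOn_univ]
  · exact Finset.prod_congr rfl fun k _ => bernoulliMeasure_real_eraseIf_eq p _ _

theorem isBECTransmission_channelOutput [Nonempty α] (p : unitInterval) (f : FeedbackEncoder α) :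
    IsBECTransmission p (messageErasureMeasure α p) (fun _ : Unit => f) (fun _ => ()) Prod.fst
      (fun n ω => channelOutput f ω.1 ω.2 n) where
  measurable_U := measurable_const
  measurable_W := measurable_fst
  measurable_Y := measurable_channelOutput f
  uniform_W w := by simpa using messageErasureMeasure_real_eq p f 0 w fun _ => none
  indep_U_W := indepFun_const_left () _
  channel n u w y b := by
    obtain ⟨z, rfl, rfl⟩ := exists_extension y b
    have h := messageErasureMeasure_real_eq p f (n + 1) w z
    rw [Finset.prod_range_succ, ← mul_assoc, ← messageErasureMeasure_real_eq] at h
    simp only [Nat.forall_lt_succ_right] at h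
    simpa [Fin.forall_iff] using h

end Construction

section Achievability

theorem isStoppingTime_find {Ω : Type*} {m : MeasurableSpace Ω} {f : Filtration ℕ m}
    {p : ℕ → Ω → Prop} [∀ ω, DecidablePred (p · ω)] (hp : ∀ n, MeasurableSet[f n] {ω | p n ω})
    (h : ∀ ω, ∃ n, p n ω) : IsStoppingTime f fun ω => (Nat.find (h ω) : WithTop ℕ) := by
  intro n
  have h_le : {ω | (Nat.find (h ω) : WithTop ℕ) ≤ (n : WithTop ℕ)} =
      ⋃ k ∈ Set.Iic n, {ω | p k ω} := by
    ext ω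
    simp [Nat.find_le_iff]
  exact h_le ▸ .biUnion (Set.to_countable _) fun k hk => f.mono hk _ (hp k)

theorem measurePreserving_subtype_coe_of_ae {Ω : Type*} [MeasurableSpace Ω] {μ : Measure Ω}
    {p : Ω → Prop} (hp : MeasurableSet {ω | p ω}) (h : ∀ᵐ ω ∂μ, p ω) :
    MeasurePreserving (Subtype.val : {ω // p ω} → Ω) (μ.comap Subtype.val) μ := by
  have h_restrict := measurePreserving_subtype_coe (μa := μ) hp
  rwa [Measure.restrict_eq_self_of_ae_mem (s := {ω | p ω}) h] at h_restrict

namespace IsBECTransmission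

variable {Ω S α : Type*} [MeasurableSpace Ω] [MeasurableSpace S] [Fintype α] [MeasurableSpace α]
  {δ : ℝ} {μ : Measure Ω} {enc : S → FeedbackEncoder α} {U : Ω → S} {W : Ω → α}
  {Y : ℕ → Ω → BECOutput}

theorem isStoppingTime_find_ambiguity_le_one {Ω S : Type} [MeasurableSpace Ω]
    [MeasurableSpace S] [Countable S] [MeasurableSingletonClass S] {μ : Measure Ω}
    {enc : S → FeedbackEncoder α} {U : Ω → S} {W : Ω → α} {Y : ℕ → Ω → BECOutput}
    (h : IsBECTransmission δ μ enc U W Y)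
    (h_end : ∀ ω, ∃ n, ambiguity enc (history U Y n ω) ≤ 1) :
    IsStoppingTime (feedbackFiltration U Y h.measurable_U h.measurable_Y)
      fun ω => (Nat.find (h_end ω) : WithTop ℕ) := by
  refine isStoppingTime_find (fun n => ?_) h_end
  rw [feedbackFiltration_eq_comap_history]
  exact ⟨{x | ambiguity enc x ≤ 1}, .of_discrete, rfl⟩

variable [MeasurableSingletonClass S] [MeasurableSingletonClass α]

theorem comp {Ω' : Type*} [MeasurableSpace Ω'] {ν : Measure Ω'} {r : Ω' → Ω}
    (h : IsBECTransmission δ μ enc U W Y) (hr : MeasurePreserving r ν μ) :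
    IsBECTransmission δ ν enc (U ∘ r) (W ∘ r) fun n => Y n ∘ r where
  measurable_U := h.measurable_U.comp hr.measurable
  measurable_W := h.measurable_W.comp hr.measurable
  measurable_Y n := (h.measurable_Y n).comp hr.measurable
  uniform_W w := by
    rw [← h.uniform_W w]
    exact hr.measureReal_preimage (h.measurable_W (.singleton w)).nullMeasurableSet
  indep_U_W := by
    rw [indepFun_iff_measure_inter_preimage_eq_mul]
    intro s t hs ht
    simp only [Set.preimage_comp, ← Set.preimage_inter]
    have hUs := h.measurable_U hs
    have hWt := h.measurable_W ht
    rw [hr.measure_preimage (hUs.inter hWt).nullMeasurableSet,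
      hr.measure_preimage hUs.nullMeasurableSet, hr.measure_preimage hWt.nullMeasurableSet,
      h.indep_U_W.measure_inter_preimage_eq_mul _ _ hs ht]
  channel n u w y b := by
    have hU := h.measurable_U (.singleton u)
    have hW := h.measurable_W (.singleton w)
    have hY : MeasurableSet {ω | ∀ k : Fin n, Y k ω = y k} := by
      simpa only [Set.ofPred_forall] using
        .iInter fun k : Fin n => h.measurable_Y k (.singleton (y k))
    have hb := h.measurable_Y n (.singleton b)
    have h_next := hr.measureReal_preimage (hU.inter (hW.inter (hY.inter hb))).nullMeasurableSet
    have h_past := hr.measureReal_preimage (hU.inter (hW.inter hY)).nullMeasurableSet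
    exact h_next.trans ((h.channel n u w y b).trans (congrArg (· * _) h_past.symm))

theorem sum_measureReal_two_le_ambiguity_le [IsProbabilityMeasure μ] [Finite S]
    (h : IsBECTransmission δ μ enc U W Y) (h_halving : ∀ u, IsHalving (enc u)) (hδ : δ < 1)
    (N : ℕ) :
    ∑ n ∈ Finset.range N, μ.real {ω | 2 ≤ ambiguity enc (history U Y n ω)} ≤
      lstar (Fintype.card α) / (1 - δ) := by
  have h_remaining : 0 ≤ ∫ ω, lstar (ambiguity enc (history U Y N ω)) ∂μ :=
    integral_nonneg fun ω => lstar_natCast_nonneg _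
  rw [le_div_iff₀' (sub_pos.2 hδ), h.lstar_card_eq h_halving N]
  exact le_add_of_nonneg_left h_remaining

theorem ae_exists_ambiguity_le_one [IsProbabilityMeasure μ] [Finite S]
    (h : IsBECTransmission δ μ enc U W Y) (h_halving : ∀ u, IsHalving (enc u)) (hδ : δ < 1) :
    ∀ᵐ ω ∂μ, ∃ n, ambiguity enc (history U Y n ω) ≤ 1 := by
  have h_tendsto : Filter.Tendsto (fun n => μ.real {ω | 2 ≤ ambiguity enc (history U Y n ω)})
      Filter.atTop (nhds 0) :=
    (summable_of_sum_range_le (fun _ => measureReal_nonneg)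
      (h.sum_measureReal_two_le_ambiguity_le h_halving hδ)).tendsto_atTop_zero
  rw [ae_iff, ← measureReal_eq_zero_iff]
  refine le_antisymm (ge_of_tendsto' h_tendsto fun n => measureReal_mono fun ω hω => ?_)
    measureReal_nonneg
  exact not_le.1 fun h_le => hω ⟨n, h_le⟩

theorem ae_survivors_eq_singleton [IsFiniteMeasure μ] [Finite S]
    (h : IsBECTransmission δ μ enc U W Y) :
    ∀ᵐ ω ∂μ, ∀ n, ambiguity enc (history U Y n ω) ≤ 1 →
      survivors (enc (U ω)) n (history U Y n ω).2 = {W ω} := by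
  filter_upwards [ae_all_iff.2 h.ae_mem_survivors] with ω hω n hn
  exact Finset.eq_singleton_iff_unique_mem.2
    ⟨(hω n).1, fun w hw => Finset.card_le_one.1 hn w hw _ (hω n).1⟩

section Codes

variable {Ω S : Type} [MeasurableSpace Ω] [MeasurableSpace S] [DiscreteMeasurableSpace S]
  {μ : Measure Ω} {enc : S → FeedbackEncoder α} {U : Ω → S} {W : Ω → α} {Y : ℕ → Ω → BECOutput}

theorem lintegral_find_ambiguity_le_one_le [IsProbabilityMeasure μ] [Finite S]
    (h : IsBECTransmission δ μ enc U W Y) (h_halving : ∀ u, IsHalving (enc u)) (hδ : δ < 1)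
    (h_end : ∀ ω, ∃ n, ambiguity enc (history U Y n ω) ≤ 1) :
    ∫⁻ ω, (Nat.find (h_end ω) : ℝ≥0∞) ∂μ ≤
      ENNReal.ofReal (lstar (Fintype.card α) / (1 - δ)) := by
  have h_meas := measurable_of_isStoppingTime (h.isStoppingTime_find_ambiguity_le_one h_end)
  have h_nonneg : 0 ≤ lstar (Fintype.card α) / (1 - δ) :=
    div_nonneg (lstar_natCast_nonneg _) (sub_pos.2 hδ).le
  refine (lintegral_natCast_le_ofReal_iff h_meas h_nonneg).2 fun N => le_trans ?_
    (h.sum_measureReal_two_le_ambiguity_le h_halving hδ N)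
  refine Finset.sum_le_sum fun n _ => measureReal_mono fun ω hω => ?_
  exact not_le.1 (Nat.find_min (h_end ω) hω)

theorem nonempty_vlfCode_of_forall {M : ℕ} [Fintype S] [IsProbabilityMeasure μ]
    {enc : S → FeedbackEncoder (Fin M)} {W : Ω → Fin M} (h : IsBECTransmission δ μ enc U W Y)
    (hS : Fintype.card S ≤ 2) (h_halving : ∀ u, IsHalving (enc u)) (hδ : δ < 1)
    (h_end : ∀ ω, ∃ n, ambiguity enc (history U Y n ω) ≤ 1) :
    Nonempty (VLFCode δ (lstar M / (1 - δ)) M 0) := by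
  have : Nonempty (Fin M) := (nonempty_of_isProbabilityMeasure μ).map W
  let dec (n : ℕ) (u : S) (y : Fin n → BECOutput) : Fin M :=
    Classical.epsilon (· ∈ survivors (enc u) n y)
  have h_correct : ∀ᵐ ω ∂μ, dec (Nat.find (h_end ω)) (U ω) (fun k => Y k ω) = W ω := by
    filter_upwards [h.ae_survivors_eq_singleton] with ω hω
    have h_survivors := hω _ (Nat.find_spec (h_end ω))
    have h_mem := h_survivors.superset (Finset.mem_singleton_self (W ω))
    exact Finset.mem_singleton.1 (h_survivors.subset (Classical.epsilon_spec ⟨W ω, h_mem⟩))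
  exact ⟨{
    L_nonneg := div_nonneg (lstar_natCast_nonneg M) (sub_pos.2 hδ).le
    ε_mem := ⟨le_rfl, zero_le_one⟩
    S := S
    card_S_le := hS
    enc := fun n u => enc u n
    dec := dec
    Ω := Ω
    μ := μ
    U := U
    W := W
    Y := Y
    measurable_U := h.measurable_U
    measurable_W := h.measurable_W
    measurable_Y := h.measurable_Y
    uniform_W := by simpa using h.uniform_W
    indep_U_W := h.indep_U_W
    channel := h.channel
    τ := fun ω => Nat.find (h_end ω)
    isStoppingTime := h.isStoppingTime_find_ambiguity_le_one h_end
    expectation_le := by simpa using h.lintegral_find_ambiguity_le_one_le h_halving hδ h_end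
    error_le := ((measureReal_eq_zero_iff (measure_ne_top _ _)).2 h_correct).le }⟩

theorem nonempty_vlfCode {M : ℕ} [Fintype S] [IsProbabilityMeasure μ]
    {enc : S → FeedbackEncoder (Fin M)} {W : Ω → Fin M} (h : IsBECTransmission δ μ enc U W Y)
    (hS : Fintype.card S ≤ 2) (h_halving : ∀ u, IsHalving (enc u)) (hδ : δ < 1) :
    Nonempty (VLFCode δ (lstar M / (1 - δ)) M 0) := by
  have h_meas : MeasurableSet {ω | ∃ n, ambiguity enc (history U Y n ω) ≤ 1} := by
    rw [Set.ofPred_exists]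
    exact .iUnion fun n => h.measurable_history n (.of_discrete (s := {x | ambiguity enc x ≤ 1}))
  -- The first time with at most one surviving message is a natural number only on this event of
  -- full measure, so the code lives on the event instead of on all of `Ω`.
  have h_coe := measurePreserving_subtype_coe_of_ae h_meas
    (h.ae_exists_ambiguity_le_one h_halving hδ)
  have : IsProbabilityMeasure (μ.comap (Subtype.val : {ω // _} → Ω)) :=
    (Measure.isProbabilityMeasure_map_iff h_coe.aemeasurable).1 (by rwa [h_coe.map_eq])
  exact (h.comp h_coe).nonempty_vlfCode_of_forall hS h_halving hδ Subtype.property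

end Codes

end IsBECTransmission

theorem nonempty_vlfCode {δ : ℝ} (hδ0 : 0 ≤ δ) (hδ1 : δ < 1) {M : ℕ} (hM : 1 ≤ M) :
    Nonempty (VLFCode δ (lstar M / (1 - δ)) M 0) := by
  have : Nonempty (Fin M) := ⟨⟨0, hM⟩⟩
  obtain ⟨f, hf⟩ := exists_isHalving (Fin M)
  exact (isBECTransmission_channelOutput ⟨δ, hδ0, hδ1.le⟩ f).nonempty_vlfCode (by simp)
    (fun _ => hf) hδ1

end Achievability

theorem mainTheorem3 (δ : ℝ) (hδ0 : 0 ≤ δ) (hδ1 : δ < 1) (M : ℕ) (hM : 1 ≤ M) :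
    IsLeast (vlfBlocklengths δ M 0) (lstar (M : ℝ) / (1 - δ)) :=
  ⟨nonempty_vlfCode hδ0 hδ1 hM, fun _ ⟨C⟩ => C.lstar_div_le hδ0 hδ1⟩
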